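/- **Setting.** Let $\mathcal X\subseteq[0,1]^D$ be compact, let $\Theta\subseteq\mathbb R^V$ with task parameters $\theta_1,\dots,\theta_K\in\Theta$, and let there be $M$ objectives, observed with independent Gaussian noise of variances $0<v_m\le\sigma^2$ ($m\in[M]$). *Single-task model (ST-MOBO).* For all $m,k$ the objective $f_m(\cdot,\theta_k)$ is a Gaussian process on $\mathcal X$ with some mean function, covariance kernel $\kappa_m$ and marginal variances at most $1$. *Task-aware model (PMT-MOBO).* For all $m$ the objective $f_m$ is a Gaussian process on $\mathcal X\times\Theta$ with some mean function, covariance kernel $\tilde\kappa_m$ and marginal variances at most $1$. In both models the observations are $y^{(t)}_{m,k}=f_m(x_k^{(t)},\theta_k)+\epsilon^{(t)}_{m,k}$ with noises $\epsilon^{(t)}_{m,k}\sim\mathcal N(0,v_m)$ that, for each $m$, are independent of each other and of $f_m$. The scalarizations $\mathfrak s_\lambda:\mathbb R^M\to\mathbb R$, $\lambda\in\Lambda$ ($\Lambda$ a bounded subset of a normed space), are nondecreasing in every coordinate and $J_\lambda$-Lipschitz in the $\ell_1$-norm with $J_\lambda\le J$. Let $p$ be a probability distribution of preference vectors on $\Lambda$.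 **Information gains.** Let $I$ denote (conditional) mutual information. For a task $k$ put $\mathbf f_{m,k}=(f_m(x_k^{(t)},\theta_k))_{t=1}^T$ and $\mathbf y_{m,k}=(y^{(t)}_{m,k})_{t=1}^T$. Define $$\gamma_{T,m,k}=\sup_{x_k^{(1)},\dots,x_k^{(T)}\in\mathcal X} I(\mathbf y_{m,k};\mathbf f_{m,k})\ \text{(single-task model)},\qquad \gamma_{T,k}=\max_m\gamma_{T,m,k}.$$ For arbitrary fixed inputs $z_j^{(1)},\dots,z_j^{(T)}\in\mathcal X$ of the other tasks $j\ne k$, define $$\tilde\gamma_{T,m,k}=\sup_{x_k^{(1)},\dots,x_k^{(T)}\in\mathcal X} I\bigl(\mathbf y_{m,k};\mathbf f_{m,k}\,\big|\,(\mathbf y_{m,j})_{j\neq k}\bigr)\ \text{(task-aware model)},\qquad \tilde\gamma_{T,k}=\max_m\tilde\gamma_{T,m,k},$$ where $\mathbf y_{m,j}$ are the noisy observations of task $j$ at the inputs $z_j^{(t)}$. **Bound expressions.** For a constant $C\ge0$ and a sequence $r$, put $$\rho_T(\gamma)=J\sqrt{M^2\,T\,D\,\gamma\,\frac{\ln T}{\ln(1+\sigma^{-2})}},\qquad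 U_{C,r,T}(\gamma)=\frac1T\,C\,\rho_T(\gamma)+r(T).$$ $U_{C,r,T}(\gamma_{T,k})$ is the upper bound on the expected Bayes regret of ST-MOBO that results from the known bounds $\mathbb E[\mathcal R_C(T)]=\mathcal O(\rho_T(\gamma_{T,k}))$ and $\mathbb E[\mathcal R_B(T)]\le\frac1T\mathbb E[\mathcal R_C(T)]+o(1)$, with $C$ the constant of the first bound and $r$ the remainder of the second. **Regrets.** PMT-MOBO proceeds in rounds $t=1,2,\dots$. In round $t$ it draws $\lambda^{(t)}\sim p$, independently over the rounds and of the objectives and noise. For every task $k$ it then evaluates a maximizer $x_k^{(t)}$ over $x\in\mathcal X$ of $\mathfrak s_{\lambda^{(t)}}\bigl(-\tilde\mu(x,\theta_k)+\beta_t^{1/2}\tilde\sigma(x,\theta_k)\bigr)$. Here $\beta_t\ge0$, and $\tilde\mu,\tilde\sigma$ are the vectors of posterior means and standard deviations of the task-aware Gaussian processes given the observations of all tasks in the earlier rounds. For task $k$ write $F=(f_1(\cdot,\theta_k),\dots,f_M(\cdot,\theta_k))$ and let $\mathcal X^*$ be the set of all minimizers of $\mathfrak s_\lambda\circ F$ over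 $\mathcal X$, $\lambda\in\Lambda$. Put $$\mathcal R_C(T)=\sum_{t=1}^T\Bigl[\mathfrak s_{\lambda^{(t)}}(F(x_k^{(t)}))-\min_{x\in\mathcal X^*}\mathfrak s_{\lambda^{(t)}}(F(x))\Bigr],\qquad \mathcal R_B(T)=\mathbb E_{\lambda\sim p}\Bigl[\min_{t\le T}\mathfrak s_\lambda(F(x_k^{(t)}))-\min_{x\in\mathcal X^*}\mathfrak s_\lambda(F(x))\Bigr],$$ it being presupposed that almost surely the scalarized problems have minimizers and that the expectations exist. **Theorem (Tightened regret bounds for PMT-MOBO).** Suppose that $\tilde\kappa_m\bigl((x,\theta_k),(x',\theta_k)\bigr)=\kappa_m(x,x')$ for all $m\in[M]$, $k\in[K]$, $x,x'\in\mathcal X$. Then, for all $T$ and all inputs $z_j^{(t)}$ of the other tasks: 1. $\tilde\gamma_{T,m,k}\le\gamma_{T,m,k}<\infty$ for all $m\in[M]$, $k\in[K]$. 2. $\tilde\gamma_{T,k}\le\gamma_{T,k}$ for all $k\in[K]$. 3. The regret bounds are no larger for PMT-MOBO: for all $k$, $\rho_T(\tilde\gamma_{T,k})\le\rho_T(\gamma_{T,k})$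 and $U_{C,r,T}(\tilde\gamma_{T,k})\le U_{C,r,T}(\gamma_{T,k})$ for all $C\ge0$ and $r$. 4. Consequently, fix a task $k$ and, for every $T$, inputs of the other tasks. Suppose the two known regret bounds hold for PMT-MOBO with $\tilde\gamma_{T,k}$ in place of $\gamma_{T,k}$, i.e. there are $C\ge0$ and $r(T)\to0$ with $\mathbb E[\mathcal R_C^{\rm PMT}(T)]\le C\rho_T(\tilde\gamma_{T,k})$ and $\mathbb E[\mathcal R_B^{\rm PMT}(T)]\le\frac1T\mathbb E[\mathcal R_C^{\rm PMT}(T)]+r(T)$ for all large $T$. Then for all large $T$ $$\mathbb E[\mathcal R_B^{\rm PMT}(T)]\le U_{C,r,T}(\tilde\gamma_{T,k})\le U_{C,r,T}(\gamma_{T,k}).$$ -/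

import Mathlib

open MeasureTheory ProbabilityTheory Filter Topology
open scoped NNReal ENNReal

namespace PMTMOBO

noncomputable section

/-! ### Mutual information -/

section Information

variable {Ω A B Z : Type*} [MeasurableSpace Ω] [MeasurableSpace A] [MeasurableSpace B]
  [MeasurableSpace Z]

/-- Mutual information `I(Y; F)`: the Kullback-Leibler divergence of the joint law from the product
of the marginal laws. -/
def mutualInfo (P : Measure Ω) (Y : Ω → A) (F : Ω → B) : ℝ≥0∞ :=
  InformationTheory.klDiv (P.map fun ω => (Y ω, F ω)) ((P.map Y).prod (P.map F))

/-- Conditional mutual information `I(Y; F | W)`: the Kullback-Leibler divergence of the joint law of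
`(W, (Y, F))` from the law under which `W` keeps its distribution and `Y`, `F` are conditionally
independent given `W` with their own regular conditional distributions. -/
def condMutualInfo [StandardBorelSpace A] [Nonempty A] [StandardBorelSpace B] [Nonempty B]
    (P : Measure Ω) [IsFiniteMeasure P] (Y : Ω → A) (F : Ω → B) (W : Ω → Z) : ℝ≥0∞ :=
  InformationTheory.klDiv (P.map fun ω => (W ω, (Y ω, F ω)))
    ((P.map W) ⊗ₘ ((condDistrib Y W P) ×ₖ (condDistrib F W P)))

end Information

/-! ### Gaussian process models with noisy observations -/

section GP

variable {Ω S N : Type*} [MeasurableSpace Ω]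

/-- On the domain `I`, the random function `f` is a Gaussian process with mean function `mean` and
covariance function `κ` whose marginal variances are at most `1`; the observation noises `ε n` are
independent, `N(0, v)`-distributed and independent of `f`. -/
structure IsNoisyGP (P : Measure Ω) (I : Set S) (f : S → Ω → ℝ) (mean : S → ℝ) (κ : S → S → ℝ)
    (ε : N → Ω → ℝ) (v : ℝ≥0) : Prop where
  gaussian : IsGaussianProcess (fun (q : I) ω => f q ω) P
  mean_eq : ∀ q ∈ I, ∫ ω, f q ω ∂P = mean q
  cov_eq : ∀ q ∈ I, ∀ q' ∈ I, covariance (f q) (f q') P = κ q q'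
  variance_le_one : ∀ q ∈ I, κ q q ≤ 1
  noise_law : ∀ n, HasLaw (ε n) (gaussianReal 0 v) P
  noise_iIndep : iIndepFun ε P
  noise_indep : IndepFun (fun ω (q : I) => f q ω) (fun ω n => ε n ω) P

/-- The matrix `K + v I`, where `K` is the kernel matrix of the inputs `z`. -/
def noisyGram {ι : Type*} [DecidableEq ι] (κ : S → S → ℝ) (v : ℝ≥0) (z : ι → S) : Matrix ι ι ℝ :=
  Matrix.of (fun i j => κ (z i) (z j)) + (v : ℝ) • (1 : Matrix ι ι ℝ)

/-- Posterior mean at `q`, given observations `y` at the inputs `z` with noise variance `v`. -/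
def postMean {ι : Type*} [Fintype ι] [DecidableEq ι] (mean : S → ℝ) (κ : S → S → ℝ) (v : ℝ≥0)
    (z : ι → S) (y : ι → ℝ) (q : S) : ℝ :=
  mean q + (fun i => κ (z i) q) ⬝ᵥ ((noisyGram κ v z)⁻¹.mulVec fun i => y i - mean (z i))

/-- Posterior variance at `q`, given observations at the inputs `z` with noise variance `v`. -/
def postVar {ι : Type*} [Fintype ι] [DecidableEq ι] (κ : S → S → ℝ) (v : ℝ≥0)
    (z : ι → S) (q : S) : ℝ :=
  κ q q - (fun i => κ (z i) q) ⬝ᵥ ((noisyGram κ v z)⁻¹.mulVec fun i => κ (z i) q)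

end GP

/-! ### Maximum information gains -/

section MIG

variable {Ω X Θ : Type*} [MeasurableSpace Ω] {M K : ℕ}

/-- Single-task maximum information gain of one objective `g`: the supremum, over all designs of `T`
inputs in `𝒳`, of the mutual information between the noisy observations and the function values. -/
def stMIG (P : Measure Ω) (𝒳 : Set X) (g : X → Ω → ℝ) (ε : ℕ → Ω → ℝ) (T : ℕ) : ℝ≥0∞ :=
  ⨆ x : Fin T → 𝒳,
    mutualInfo P (fun ω (t : Fin T) => g (x t) ω + ε t ω) (fun ω (t : Fin T) => g (x t) ω)

/-- Largest single-task maximum information gain over the `M` objectives. -/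
def stMIGMax (P : Measure Ω) (𝒳 : Set X) (g : Fin M → X → Ω → ℝ) (ε : Fin M → ℕ → Ω → ℝ)
    (T : ℕ) : ℝ≥0∞ :=
  ⨆ m, stMIG P 𝒳 (g m) (ε m) T

/-- Multi-task maximum information gain of one objective `f` for the task `k`: the supremum, over
all designs of `T` inputs in `𝒳` for task `k`, of the mutual information between the noisy
observations and the function values of task `k`, conditionally on the noisy observations of all the
other tasks `j ≠ k` at their inputs `z j`. -/
def pmtMIG (P : Measure Ω) [IsFiniteMeasure P] (𝒳 : Set X) (θ : Fin K → Θ) (f : X × Θ → Ω → ℝ)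
    (ε : Fin K × ℕ → Ω → ℝ) (k : Fin K) (T : ℕ) (z : Fin K → Fin T → 𝒳) : ℝ≥0∞ :=
  ⨆ x : Fin T → 𝒳,
    condMutualInfo P
      (fun ω (t : Fin T) => f (x t, θ k) ω + ε (k, t) ω)
      (fun ω (t : Fin T) => f (x t, θ k) ω)
      (fun ω (i : {j : Fin K // j ≠ k} × Fin T) =>
        f (z i.1 i.2, θ i.1) ω + ε (i.1, i.2) ω)

/-- Largest multi-task maximum information gain over the `M` objectives. -/
def pmtMIGMax (P : Measure Ω) [IsFiniteMeasure P] (𝒳 : Set X) (θ : Fin K → Θ)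
    (f : Fin M → X × Θ → Ω → ℝ) (ε : Fin M → Fin K × ℕ → Ω → ℝ) (k : Fin K) (T : ℕ)
    (z : Fin K → Fin T → 𝒳) : ℝ≥0∞ :=
  ⨆ m, pmtMIG P 𝒳 θ (f m) (ε m) k T z

end MIG

/-! ### Scalarizations, regrets and regret bounds -/

section Regret

variable {X L : Type*} {M : ℕ}

/-- The scalarizations `s l`, `l ∈ Λ`, are monotone in every objective and `Jl l`-Lipschitz for the
`ℓ¹` norm, with `Jl l ≤ J`; the preference set `Λ` is bounded. -/
structure IsScalarization [NormedAddCommGroup L] (Λ : Set L) (s : L → (Fin M → ℝ) → ℝ)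
    (Jl : L → ℝ≥0) (J : ℝ≥0) : Prop where
  bounded : Bornology.IsBounded Λ
  lipschitz : ∀ l ∈ Λ, ∀ y y' : Fin M → ℝ, |s l y - s l y'| ≤ Jl l * ∑ m, |y m - y' m|
  lipschitz_le : ∀ l ∈ Λ, Jl l ≤ J
  monotone : ∀ l ∈ Λ, Monotone (s l)

/-- The Pareto set: all minimizers over `𝒳` of the scalarized objectives. -/
def paretoSet (𝒳 : Set X) (Λ : Set L) (s : L → (Fin M → ℝ) → ℝ) (F : X → Fin M → ℝ) : Set X :=
  {x | x ∈ 𝒳 ∧ ∃ l ∈ Λ, IsMinOn (fun x' => s l (F x')) 𝒳 x}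

/-- The optimal scalarized value over the Pareto set. -/
def optValue (𝒳 : Set X) (Λ : Set L) (s : L → (Fin M → ℝ) → ℝ) (F : X → Fin M → ℝ) (l : L) : ℝ :=
  sInf ((fun x => s l (F x)) '' paretoSet 𝒳 Λ s F)

/-- Cumulative regret of the solutions `x 0, …, x (T - 1)` for the preferences `lam t`. -/
def cumulativeRegret (𝒳 : Set X) (Λ : Set L) (s : L → (Fin M → ℝ) → ℝ) (F : X → Fin M → ℝ)
    (lam : ℕ → L) (x : ℕ → X) (T : ℕ) : ℝ :=
  ∑ t ∈ Finset.range T, (s (lam t) (F (x t)) - optValue 𝒳 Λ s F (lam t))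

/-- Regret of the solution set `{x 0, …, x (T - 1)}` for one preference vector `l`. -/
def prefRegret (𝒳 : Set X) (Λ : Set L) (s : L → (Fin M → ℝ) → ℝ) (F : X → Fin M → ℝ)
    (x : ℕ → X) (T : ℕ) (l : L) : ℝ :=
  (⨅ t : Fin T, s l (F (x t))) - optValue 𝒳 Λ s F l

/-- Bayes regret of the solution set `{x 0, …, x (T - 1)}` for the preference distribution `p`. -/
def bayesRegret [MeasurableSpace L] (p : Measure L) (𝒳 : Set X) (Λ : Set L)
    (s : L → (Fin M → ℝ) → ℝ) (F : X → Fin M → ℝ) (x : ℕ → X) (T : ℕ) : ℝ :=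
  ∫ l, prefRegret 𝒳 Λ s F x T l ∂p

/-- The regrets of a random run `x` on the random objective vector `F` are meaningful: the
scalarized problems have minimizers and the expectations exist. -/
structure RegretsWellDefined {Ω : Type*} [MeasurableSpace Ω] [MeasurableSpace L] (P : Measure Ω)
    (p : Measure L) (𝒳 : Set X) (Λ : Set L) (s : L → (Fin M → ℝ) → ℝ) (F : Ω → X → Fin M → ℝ)
    (lam : ℕ → Ω → L) (x : ℕ → Ω → X) : Prop where
  attained : ∀ᵐ ω ∂P, ∀ l ∈ Λ, ∃ x' ∈ 𝒳, IsMinOn (fun x'' => s l (F ω x'')) 𝒳 x'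
  integrable_cumulative : ∀ T : ℕ, Integrable
    (fun ω => cumulativeRegret 𝒳 Λ s (F ω) (fun t => lam t ω) (fun t => x t ω) T) P
  integrable_pref : ∀ T : ℕ, 1 ≤ T → ∀ᵐ ω ∂P,
    Integrable (prefRegret 𝒳 Λ s (F ω) (fun t => x t ω) T) p
  integrable_bayes : ∀ T : ℕ, 1 ≤ T → Integrable
    (fun ω => bayesRegret p 𝒳 Λ s (F ω) (fun t => x t ω) T) P

/-- The rate `J √(M² T D γ ln T / ln (1 + σ⁻²))`. -/
def regretRate (J : ℝ≥0) (M D : ℕ) (σ2 : ℝ≥0) (γ : ℝ≥0∞) (T : ℕ) : ℝ :=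
  J * Real.sqrt ((M : ℝ) ^ 2 * T * D * γ.toReal *
    (Real.log T / Real.log (1 + (σ2 : ℝ)⁻¹)))

/-- The upper bound on the expected Bayes regret after `T` rounds obtained from the cumulative
regret bound with constant `C` and the remainder `r`. -/
def bayesBound (J : ℝ≥0) (M D : ℕ) (σ2 : ℝ≥0) (C : ℝ) (r : ℕ → ℝ) (γ : ℝ≥0∞) (T : ℕ) : ℝ :=
  1 / (T : ℝ) * (C * regretRate J M D σ2 γ T) + r T

end Regret

/-! ### PMT-MOBO -/

section Algorithm

variable {Ω X Θ L : Type*} [MeasurableSpace Ω] [MeasurableSpace L] {M K : ℕ}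

/-- The task-aware UCB vector at `q`, whose entries are `-μ̃ₘ(q) + β^(1/2) σ̃ₘ(q)`, computed from the
inputs `z` and the observations `y m` of the objectives. -/
def ucb {S ι : Type*} [Fintype ι] [DecidableEq ι] (mean : Fin M → S → ℝ) (κ : Fin M → S → S → ℝ)
    (v : Fin M → ℝ≥0) (β : ℝ≥0) (z : ι → S) (y : Fin M → ι → ℝ) (q : S) : Fin M → ℝ :=
  fun m => -postMean (mean m) (κ m) (v m) z (y m) q +
    Real.sqrt β * Real.sqrt (postVar (κ m) (v m) z q)

/-- `x k t` is the solution that PMT-MOBO evaluates for task `k` in round `t` (rounds are numbered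
from `0`). The preference vectors `lam t` are drawn independently from `p`, independently of the
objectives and of the noise, and are shared by the tasks. In round `t` the solution for task `k`
maximizes the scalarized UCB vector of the task-aware Gaussian processes, trained on the noisy
observations of all tasks in the earlier rounds. -/
structure IsPMTRun (P : Measure Ω) (p : Measure L) (𝒳 : Set X) (𝒯 : Set Θ) (θ : Fin K → Θ)
    (f : Fin M → X × Θ → Ω → ℝ) (ε : Fin M → Fin K × ℕ → Ω → ℝ)
    (mean : Fin M → X × Θ → ℝ) (κ : Fin M → X × Θ → X × Θ → ℝ) (v : Fin M → ℝ≥0)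
    (s : L → (Fin M → ℝ) → ℝ) (β : ℕ → ℝ≥0) (lam : ℕ → Ω → L) (x : Fin K → ℕ → Ω → X) :
    Prop where
  pref_law : ∀ t, HasLaw (lam t) p P
  pref_iIndep : iIndepFun lam P
  pref_indep : IndepFun (fun ω t => lam t ω)
    (fun ω => (fun (m : Fin M) (q : 𝒳 ×ˢ 𝒯) => f m q ω, fun m n => ε m n ω)) P
  mem : ∀ᵐ ω ∂P, ∀ k t, x k t ω ∈ 𝒳
  select : ∀ᵐ ω ∂P, ∀ (k : Fin K) (t : ℕ),
    IsMaxOn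
      (fun x' => s (lam t ω)
        (ucb mean κ v (β t)
          (fun i : Fin K × Fin t => (x i.1 i.2 ω, θ i.1))
          (fun m i => f m (x i.1 i.2 ω, θ i.1) ω + ε m (i.1, i.2) ω)
          (x', θ k)))
      𝒳 (x k t ω)

end Algorithm

end

end PMTMOBO

/-! Given the values `F` of task `k`, its observations `Y = F + E` involve only fresh noise `E`,
while the observations `W` of the other tasks involve other noise variables. So `W - F - Y` is a
Markov chain, and the chain rule for the Kullback-Leibler divergence gives `I(Y; F | W) ≤ I(Y; F)`
(`condMutualInfo_le_mutualInfo_of_markov`). No relation between the tasks is needed here, only the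
independence of the noise.

The unconditional gain depends only on the covariance matrix of `F` and the noise variance, since
means can be subtracted and Gaussian vectors are determined by mean and covariance. Within one task
the two kernels agree, so this gain is the single-task one (`IsNoisyGP.mutualInfo_eq`), and suprema
over designs and maxima over objectives preserve the inequality.

The regret expressions use the gain as a real number through `toReal`, so monotonicity needs a
finite single-task gain. A bound uniform over designs comes from comparing the noise with a randomly
shifted copy of itself (`mutualInfo_add_gaussian_le`). It requires no invertible Gram matrix. The
rest is monotonicity of the square root and chaining the two assumed regret bounds. -/

namespace PMTMOBO

open InformationTheory

/-! ### Data processing, the chain rule and conditioning along a Markov chain. -/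

section InformationInequalities

variable {Ω A B Z : Type*} [MeasurableSpace Ω] [MeasurableSpace A] [MeasurableSpace B]
  [MeasurableSpace Z]

/-- Data processing: transforming both variables separately does not increase their mutual
information. -/
theorem mutualInfo_comp_le {A' B' : Type*} [MeasurableSpace A'] [MeasurableSpace B']
    {P : Measure Ω} [IsProbabilityMeasure P] {Y : Ω → A} {F : Ω → B} (hY : AEMeasurable Y P)
    (hF : AEMeasurable F P) {φ : A → A'} {ψ : B → B'} (hφ : Measurable φ) (hψ : Measurable ψ) :
    mutualInfo P (fun ω => φ (Y ω)) (fun ω => ψ (F ω)) ≤ mutualInfo P Y F := by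
  have := Measure.isProbabilityMeasure_map hY
  have := Measure.isProbabilityMeasure_map hF
  have h1 : P.map (fun ω => (φ (Y ω), ψ (F ω))) =
      (P.map fun ω => (Y ω, F ω)).map (Prod.map φ ψ) := by
    rw [AEMeasurable.map_map_of_aemeasurable (by fun_prop) (by fun_prop)]
    rfl
  have h2 : (P.map fun ω => φ (Y ω)).prod (P.map fun ω => ψ (F ω)) =
      ((P.map Y).prod (P.map F)).map (Prod.map φ ψ) := by
    rw [← Measure.map_prod_map _ _ hφ hψ,
      AEMeasurable.map_map_of_aemeasurable (by fun_prop) (by fun_prop),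
      AEMeasurable.map_map_of_aemeasurable (by fun_prop) (by fun_prop)]
    rfl
  rw [mutualInfo, mutualInfo, h1, h2]
  exact klDiv_map_le _ _ (hφ.prodMap hψ)

/-- Mutual information depends only on the joint law. -/
theorem mutualInfo_congr {Ω' : Type*} [MeasurableSpace Ω'] {P : Measure Ω} {P' : Measure Ω'}
    {Y : Ω → A} {F : Ω → B} {Y' : Ω' → A} {F' : Ω' → B} (hY : AEMeasurable Y P)
    (hF : AEMeasurable F P) (hY' : AEMeasurable Y' P') (hF' : AEMeasurable F' P')
    (h : P.map (fun ω => (Y ω, F ω)) = P'.map fun ω => (Y' ω, F' ω)) :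
    mutualInfo P Y F = mutualInfo P' Y' F' := by
  have h1 : P.map Y = P'.map Y' := by
    rw [← Measure.fst_map_prodMk₀ hF, h, Measure.fst_map_prodMk₀ hF']
  have h2 : P.map F = P'.map F' := by
    rw [← Measure.snd_map_prodMk₀ hY, h, Measure.snd_map_prodMk₀ hY']
  rw [mutualInfo, mutualInfo, h, h1, h2]

/-- Disintegration of the joint law. Applied to `F` given `W` and to `W` given `F`, it exchanges the
order of conditioning. -/
theorem lintegral_condDistrib {P : Measure Ω} [IsFiniteMeasure P] [StandardBorelSpace B]
    [Nonempty B] {F : Ω → B} {W : Ω → Z} (hF : AEMeasurable F P) (hW : AEMeasurable W P)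
    {h : Z × B → ℝ≥0∞} (hh : Measurable h) :
    ∫⁻ w, ∫⁻ f, h (w, f) ∂condDistrib F W P w ∂P.map W = ∫⁻ ω, h (W ω, F ω) ∂P := by
  rw [← Measure.lintegral_compProd hh, compProd_map_condDistrib hF,
    lintegral_map' hh.aemeasurable (by fun_prop)]

/-- If `W - F - Y` is a Markov chain, then conditioning on `W` does not increase the mutual
information of `Y` and `F`. -/
theorem condMutualInfo_le_mutualInfo_of_markov [StandardBorelSpace A] [Nonempty A]
    [StandardBorelSpace B] [Nonempty B] [StandardBorelSpace Z] [Nonempty Z]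
    {P : Measure Ω} [IsProbabilityMeasure P] {Y : Ω → A} {F : Ω → B} {W : Ω → Z}
    (hY : AEMeasurable Y P) (hF : AEMeasurable F P) (hW : AEMeasurable W P)
    (hM : P.map (fun ω => ((F ω, Y ω), W ω)) =
      (P.map fun ω => (F ω, Y ω)) ⊗ₘ (condDistrib W F P).prodMkRight A) :
    condMutualInfo P Y F W ≤ mutualInfo P Y F := by
  have := Measure.isProbabilityMeasure_map hY
  have := Measure.isProbabilityMeasure_map hF
  have := Measure.isProbabilityMeasure_map hW
  have := Measure.isProbabilityMeasure_map (hF.prodMk hY)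
  have := Measure.isProbabilityMeasure_map (hW.prodMk hY)
  let φ : (B × A) × Z → (Z × A) × B := fun q => ((q.2, q.1.2), q.1.1)
  let ψ : (Z × A) × B → Z × (A × B) := fun q => (q.1.1, (q.1.2, q.2))
  have hφ : Measurable φ := by fun_prop
  have hψ : Measurable ψ := by fun_prop
  have swap : klDiv (P.map fun ω => (F ω, Y ω)) ((P.map F).prod (P.map Y)) ≤
      mutualInfo P Y F := by
    have h1 : (P.map fun ω => (F ω, Y ω)) = (P.map fun ω => (Y ω, F ω)).map Prod.swap := by
      rw [AEMeasurable.map_map_of_aemeasurable (by fun_prop) (by fun_prop)]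
      rfl
    rw [h1, ← Measure.prod_swap]
    exact klDiv_map_le _ _ measurable_swap
  have joint : ((P.map fun ω => (F ω, Y ω)) ⊗ₘ (condDistrib W F P).prodMkRight A).map φ =
      P.map fun ω => ((W ω, Y ω), F ω) := by
    rw [← hM, AEMeasurable.map_map_of_aemeasurable (by fun_prop) (by fun_prop)]
    rfl
  -- Up to reordering, both sides are the law of `(W, F)` times the law of `Y`, disintegrated once
  -- along `F` and once along `W`.
  have ref : (((P.map F).prod (P.map Y)) ⊗ₘ (condDistrib W F P).prodMkRight A).map φ =
      ((P.map W).prod (P.map Y)) ⊗ₘ (condDistrib F W P).prodMkRight A := by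
    refine Measure.ext_of_lintegral _ fun g hg => ?_
    have hgφ : Measurable fun q => g (φ q) := hg.comp hφ
    rw [lintegral_map hg hφ, Measure.lintegral_compProd hgφ,
      Measure.lintegral_compProd hg, lintegral_prod_symm _
        (Measurable.lintegral_kernel_prod_right' hgφ).aemeasurable,
      lintegral_prod_symm _ (Measurable.lintegral_kernel_prod_right' hg).aemeasurable]
    refine lintegral_congr fun y => ?_
    simp only [Kernel.prodMkRight_apply]
    rw [lintegral_condDistrib (h := fun q => g ((q.1, y), q.2)) hF hW (by fun_prop)]
    exact lintegral_condDistrib (h := fun q => g ((q.2, y), q.1)) hW hF (by fun_prop)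
  have joint' : (P.map fun ω => ((W ω, Y ω), F ω)).map ψ = P.map fun ω => (W ω, (Y ω, F ω)) := by
    rw [AEMeasurable.map_map_of_aemeasurable (by fun_prop) (by fun_prop)]
    rfl
  have ref' : ((P.map fun ω => (W ω, Y ω)) ⊗ₘ (condDistrib F W P).prodMkRight A).map ψ =
      (P.map W) ⊗ₘ (condDistrib Y W P ×ₖ condDistrib F W P) := by
    refine Measure.ext_of_lintegral _ fun g hg => ?_
    rw [lintegral_map hg hψ, Measure.lintegral_compProd (f := fun q => g (ψ q)) (hg.comp hψ),
      Measure.lintegral_compProd hg, ← compProd_map_condDistrib hY,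
      Measure.lintegral_compProd (by fun_prop)]
    refine lintegral_congr fun w => ?_
    rw [Kernel.lintegral_prod _ _ _ (by fun_prop)]
    rfl
  calc condMutualInfo P Y F W
    _ ≤ klDiv (P.map fun ω => ((W ω, Y ω), F ω))
        ((P.map fun ω => (W ω, Y ω)) ⊗ₘ (condDistrib F W P).prodMkRight A) := by
      rw [condMutualInfo, ← joint', ← ref']
      exact klDiv_map_le _ _ hψ
    _ ≤ klDiv (P.map fun ω => ((W ω, Y ω), F ω))
        (((P.map W).prod (P.map Y)) ⊗ₘ (condDistrib F W P).prodMkRight A) := by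
      -- By the chain rule the right side is the left side plus the divergence of the law of `(W,
      -- Y)` from the product of its marginals, and that term is dropped.
      rw [← compProd_map_condDistrib (X := fun ω => (W ω, Y ω)) hF,
        klDiv_compProd_eq_add _ ((P.map W).prod (P.map Y))]
      exact le_add_self
    _ ≤ klDiv ((P.map fun ω => (F ω, Y ω)) ⊗ₘ (condDistrib W F P).prodMkRight A)
        (((P.map F).prod (P.map Y)) ⊗ₘ (condDistrib W F P).prodMkRight A) := by
      rw [← joint, ← ref]
      exact klDiv_map_le _ _ hφ
    -- Both measures extend by the same kernel, which adds no divergence; on the joint law this is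
    -- the Markov property.
    _ = klDiv (P.map fun ω => (F ω, Y ω)) ((P.map F).prod (P.map Y)) := klDiv_compProd_left _ _ _
    _ ≤ mutualInfo P Y F := swap

/-- If `Y = φ (F, E)` with a noise `E` independent of `(F, W)`, then conditioning on `W` does not
increase the mutual information of `Y` and `F`. -/
theorem condMutualInfo_le_mutualInfo_of_indepFun {N : Type*} [MeasurableSpace N]
    [StandardBorelSpace A] [Nonempty A]
    [StandardBorelSpace B] [Nonempty B] [StandardBorelSpace Z] [Nonempty Z]
    {P : Measure Ω} [IsProbabilityMeasure P] {E : Ω → N} {F : Ω → B} {W : Ω → Z}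
    (hE : AEMeasurable E P) (hF : AEMeasurable F P) (hW : AEMeasurable W P)
    (hind : IndepFun (fun ω => (F ω, W ω)) E P) {φ : B × N → A} (hφ : Measurable φ) :
    condMutualInfo P (fun ω => φ (F ω, E ω)) F W ≤ mutualInfo P (fun ω => φ (F ω, E ω)) F := by
  have := Measure.isProbabilityMeasure_map hE
  have := Measure.isProbabilityMeasure_map hF
  have hFE : IndepFun F E P := hind.comp measurable_fst measurable_id
  refine condMutualInfo_le_mutualInfo_of_markov (by fun_prop) hF hW ?_
  refine Measure.ext_of_lintegral _ fun g hg => ?_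
  rw [Measure.lintegral_compProd hg, lintegral_map' hg.aemeasurable (by fun_prop)]
  have hk : Measurable fun q : B × A =>
      ∫⁻ w, g (q, w) ∂(condDistrib W F P).prodMkRight A q :=
    Measurable.lintegral_kernel_prod_right' hg
  have e1 : ∫⁻ ω, g ((F ω, φ (F ω, E ω)), W ω) ∂P =
      ∫⁻ q, g ((q.1.1, φ (q.1.1, q.2)), q.1.2) ∂(P.map fun ω => ((F ω, W ω), E ω)) := by
    rw [lintegral_map' (Measurable.aemeasurable (by fun_prop)) (by fun_prop)]
  have e2 : ∫⁻ q, ∫⁻ w, g (q, w) ∂(condDistrib W F P).prodMkRight A q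
        ∂(P.map fun ω => (F ω, φ (F ω, E ω))) =
      ∫⁻ q, ∫⁻ w, g ((q.1, φ q), w) ∂condDistrib W F P q.1
        ∂(P.map fun ω => (F ω, E ω)) := by
    rw [lintegral_map' hk.aemeasurable (by fun_prop),
      lintegral_map' (Measurable.aemeasurable (by
        exact hk.comp (measurable_fst.prodMk hφ))) (by fun_prop)]
    rfl
  -- Independence of `E` lets it be integrated last. With `E = e` fixed, `Y` is a function of `F`,
  -- and only the disintegration of `(F, W)` remains.
  rw [e1, e2, hind.map_prod_eq_prod_map_map (by fun_prop) hE, hFE.map_prod_eq_prod_map_map hF hE,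
    lintegral_prod_symm _ (Measurable.aemeasurable (by fun_prop)),
    lintegral_prod_symm _ (Measurable.aemeasurable (by
        exact hk.comp (measurable_fst.prodMk hφ)))]
  refine lintegral_congr fun e => ?_
  rw [lintegral_condDistrib (h := fun q => g ((q.1, φ (q.1, e)), q.2)) hW hF (by fun_prop),
    lintegral_map' (Measurable.aemeasurable (by fun_prop)) (by fun_prop)]

end InformationInequalities

/-! ### Finiteness of the information gain through shifted Gaussian noise. -/

section GaussianShift

/-- Logarithm of the density of `N(d, v)` with respect to `N(0, v)`. -/
noncomputable def shiftLogDensity (v : ℝ≥0) (d e : ℝ) : ℝ := (d * e - d ^ 2 / 2) / v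

@[fun_prop]
theorem measurable_shiftLogDensity {α : Type*} [MeasurableSpace α] {v : ℝ≥0} {d e : α → ℝ}
    (hd : Measurable d) (he : Measurable e) :
    Measurable fun a => shiftLogDensity v (d a) (e a) := by
  unfold shiftLogDensity
  fun_prop

theorem gaussianReal_map_const_add_eq_withDensity {v : ℝ≥0} (hv : v ≠ 0) (d : ℝ) :
    (gaussianReal 0 v).map (d + ·) =
      (gaussianReal 0 v).withDensity fun e => ENNReal.ofReal (Real.exp (shiftLogDensity v d e)) := by
  rw [gaussianReal_map_const_add, gaussianReal_of_var_ne_zero _ hv,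
    gaussianReal_of_var_ne_zero _ hv, ← withDensity_mul _ (by fun_prop) (by fun_prop)]
  congr 1
  ext e
  have hv' : (v : ℝ) ≠ 0 := by simpa using hv
  simp only [Pi.mul_apply, gaussianPDF, gaussianPDFReal, shiftLogDensity]
  rw [← ENNReal.ofReal_mul (by positivity), mul_assoc _ (Real.exp _), ← Real.exp_add]
  congr 3
  field_simp
  ring

variable {ι : Type*} [Fintype ι]

theorem pi_gaussianReal_map_const_add_eq_withDensity {v : ℝ≥0} (hv : v ≠ 0) (d : ι → ℝ) :
    (Measure.pi fun _ : ι => gaussianReal 0 v).map (d + ·) =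
      (Measure.pi fun _ : ι => gaussianReal 0 v).withDensity
        fun e => ENNReal.ofReal (Real.exp (∑ i, shiftLogDensity v (d i) (e i))) := by
  have (i : ι) : IsProbabilityMeasure ((gaussianReal 0 v).map (d i + ·)) :=
    Measure.isProbabilityMeasure_map (by fun_prop)
  have h1 : (Measure.pi fun _ : ι => gaussianReal 0 v).map (d + ·) =
      Measure.pi fun i => (gaussianReal 0 v).map (d i + ·) :=
    Measure.pi_map_pi (μ := fun _ : ι => gaussianReal 0 v) (f := fun i x => d i + x) (fun i => by fun_prop)
  rw [h1]
  refine Measure.pi_eq fun s hs => ?_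
  -- On a box, indicator times density is a product of one-variable functions, so its integral
  -- factorizes by independence of the coordinates.
  let X : ι → ℝ → ℝ≥0∞ := fun i =>
    (s i).indicator fun e => ENNReal.ofReal (Real.exp (shiftLogDensity v (d i) e))
  have hX (i : ι) : Measurable (X i) := Measurable.indicator (by fun_prop) (hs i)
  have hprod (e : ι → ℝ) : (Set.univ.pi s).indicator
      (fun e => ENNReal.ofReal (Real.exp (∑ i, shiftLogDensity v (d i) (e i)))) e =
      ∏ i, X i (e i) := by
    by_cases he : e ∈ Set.univ.pi s
    · rw [Set.indicator_of_mem he, Real.exp_sum,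
        ENNReal.ofReal_prod_of_nonneg fun i _ => (Real.exp_pos _).le]
      refine Finset.prod_congr rfl fun i _ => ?_
      simp only [X, Set.indicator_of_mem (he i (Set.mem_univ i))]
    · rw [Set.indicator_of_notMem he]
      simp only [Set.mem_univ_pi, not_forall] at he
      obtain ⟨i, hi⟩ := he
      exact (Finset.prod_eq_zero (Finset.mem_univ i) (Set.indicator_of_notMem hi _)).symm
  have hind : iIndepFun (fun i (e : ι → ℝ) => X i (e i))
      (Measure.pi fun _ : ι => gaussianReal 0 v) :=
    iIndepFun_pi fun i => (hX i).aemeasurable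
  rw [withDensity_apply _ (MeasurableSet.univ_pi hs), ← lintegral_indicator
    (MeasurableSet.univ_pi hs)]
  simp_rw [hprod]
  rw [lintegral_prod_eq_prod_lintegral_of_indepFun _ _ hind fun i =>
    (hX i).comp (measurable_pi_apply i)]
  refine Finset.prod_congr rfl fun i _ => ?_
  rw [(measurePreserving_eval (fun _ : ι => gaussianReal 0 v) i).lintegral_comp (hX i),
    gaussianReal_map_const_add_eq_withDensity hv, withDensity_apply _ (hs i),
    ← lintegral_indicator (hs i)]

/-- A randomly shifted Gaussian noise vector, together with its shift, has a density with respect to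
the unshifted one. -/
theorem prod_pi_gaussianReal_map_add_eq_withDensity {α : Type*} [MeasurableSpace α] {m : Measure α}
    [SFinite m] {v : ℝ≥0} (hv : v ≠ 0) {d : α → ι → ℝ} (hd : Measurable d) :
    (m.prod (Measure.pi fun _ : ι => gaussianReal 0 v)).map (fun q => (q.1, d q.1 + q.2)) =
      (m.prod (Measure.pi fun _ : ι => gaussianReal 0 v)).withDensity
        fun q => ENNReal.ofReal (Real.exp (∑ i, shiftLogDensity v (d q.1 i) (q.2 i))) := by
  refine Measure.ext_of_lintegral _ fun g hg => ?_
  rw [lintegral_map hg (by fun_prop), lintegral_withDensity_eq_lintegral_mul _ (by fun_prop) hg,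
    lintegral_prod _ (Measurable.aemeasurable (by fun_prop)),
    lintegral_prod _ (Measurable.aemeasurable (by fun_prop))]
  refine lintegral_congr fun a => ?_
  have h := congrArg (fun ρ => ∫⁻ e, g (a, e) ∂ρ)
    (pi_gaussianReal_map_const_add_eq_withDensity hv (d a))
  simp only at h
  rw [lintegral_map (by fun_prop) (by fun_prop),
    lintegral_withDensity_eq_lintegral_mul _ (by fun_prop) (by fun_prop)] at h
  exact h

/-- The log-likelihood ratio is almost everywhere `q`, and the mass correction in `klDiv` vanishes
between probability measures. -/
theorem klDiv_withDensity_exp {α : Type*} [MeasurableSpace α] {μ : Measure α}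
    [IsProbabilityMeasure μ] {q : α → ℝ} (hq : Measurable q)
    (hρ : IsProbabilityMeasure (μ.withDensity fun a => ENNReal.ofReal (Real.exp (q a))))
    (hint : Integrable q (μ.withDensity fun a => ENNReal.ofReal (Real.exp (q a)))) :
    klDiv (μ.withDensity fun a => ENNReal.ofReal (Real.exp (q a))) μ =
      ENNReal.ofReal (∫ a, q a ∂μ.withDensity fun a => ENNReal.ofReal (Real.exp (q a))) := by
  set ρ := μ.withDensity fun a => ENNReal.ofReal (Real.exp (q a))
  have hac : ρ ≪ μ := withDensity_absolutelyContinuous _ _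
  have hllr : llr ρ μ =ᵐ[ρ] q := by
    filter_upwards [hac.ae_le (Measure.rnDeriv_withDensity μ
      (f := fun a => ENNReal.ofReal (Real.exp (q a))) (by fun_prop))] with a ha
    rw [llr, ha, ENNReal.toReal_ofReal (Real.exp_pos _).le, Real.log_exp]
  rw [klDiv_of_ac_of_integrable hac (hint.congr hllr.symm), integral_congr_ae hllr]
  simp

theorem integral_comp_measurePreserving {α β : Type*} [MeasurableSpace α] [MeasurableSpace β]
    {μ : Measure α} {ν : Measure β} {f : α → β} (hf : MeasurePreserving f μ ν) {g : β → ℝ}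
    (hg : Measurable g) : ∫ a, g (f a) ∂μ = ∫ b, g b ∂ν := by
  rw [← hf.map_eq, integral_map hf.aemeasurable hg.aestronglyMeasurable]

/-- The mutual information between a random vector and its observation with Gaussian noise is
bounded in terms of second moments. -/
theorem mutualInfo_add_gaussian_le {Ω : Type*} [MeasurableSpace Ω] {P : Measure Ω}
    [IsProbabilityMeasure P] {v : ℝ≥0} (hv : v ≠ 0) {F E : Ω → ι → ℝ} (hF : AEMeasurable F P)
    (hE : P.map E = Measure.pi fun _ => gaussianReal 0 v) (hind : IndepFun F E P)
    (hF2 : ∀ i, MemLp (fun ω => F ω i) 2 P) {c : ℝ} (hc : ∀ i, ∫ ω, F ω i ^ 2 ∂P ≤ c) :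
    mutualInfo P (fun ω => F ω + E ω) F ≤
      ENNReal.ofReal (Fintype.card ι * ((v + 4 * c) / v)) := by
  set ν := Measure.pi fun _ : ι => gaussianReal 0 v
  have hEm : AEMeasurable E P := AEMeasurable.of_map_ne_zero (by
    rw [hE]; exact IsProbabilityMeasure.ne_zero _)
  obtain ⟨π, hπ⟩ : ∃ π, π = P.map F := ⟨_, rfl⟩
  have : IsProbabilityMeasure π := hπ ▸ Measure.isProbabilityMeasure_map hF
  set d : (ι → ℝ) × (ι → ℝ) → ι → ℝ := fun m => m.1 - m.2
  have hd : Measurable d := by fun_prop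
  set q : ((ι → ℝ) × (ι → ℝ)) × (ι → ℝ) → ℝ :=
    fun a => ∑ i, shiftLogDensity v (d a.1 i) (a.2 i)
  have hq : Measurable q := by fun_prop
  -- For a triple `((F₁, F₂), E)` of independent parts, `S` replaces `E` by `F₁ - F₂ + E`. The map
  -- `χ` below sends the triple to `(F₂ + E, F₁)`, whose components are independent, and the shifted
  -- triple to `(F₁ + E, F₁)`, the pair of interest. Data processing bounds the information by the
  -- divergence caused by the shift.
  let S : ((ι → ℝ) × (ι → ℝ)) × (ι → ℝ) → ((ι → ℝ) × (ι → ℝ)) × (ι → ℝ) :=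
    fun a => (a.1, d a.1 + a.2)
  have hS : Measurable S := by fun_prop
  have hdens : ((π.prod π).prod ν).map S = ((π.prod π).prod ν).withDensity
      fun a => ENNReal.ofReal (Real.exp (q a)) :=
    prod_pi_gaussianReal_map_add_eq_withDensity hv hd
  let χ : ((ι → ℝ) × (ι → ℝ)) × (ι → ℝ) → (ι → ℝ) × (ι → ℝ) := fun a => (a.1.2 + a.2, a.1.1)
  have hχ : Measurable χ := by fun_prop
  have hFE : P.map (fun ω => (F ω, E ω)) = π.prod ν := by
    rw [hπ, hind.map_prod_eq_prod_map_map hF hEm, hE]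
  have hY : P.map (fun ω => F ω + E ω) = (π.prod ν).map fun a => a.1 + a.2 := by
    rw [← hFE, AEMeasurable.map_map_of_aemeasurable (by fun_prop) (by fun_prop)]
    rfl
  have joint : (((π.prod π).prod ν).map S).map χ = P.map fun ω => (F ω + E ω, F ω) := by
    have h1 : (P.map fun ω => (F ω + E ω, F ω)) =
        (π.prod ν).map fun a => (a.1 + a.2, a.1) := by
      rw [← hFE, AEMeasurable.map_map_of_aemeasurable (by fun_prop) (by fun_prop)]
      rfl
    have h2 : (((π.prod π).prod ν).map fun a => (a.1.1, a.2)) = π.prod ν := by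
      have := Measure.map_prod_map (π.prod π) ν measurable_fst measurable_id
      rw [Measure.map_id, ← Measure.fst, Measure.fst_prod] at this
      exact this.symm
    rw [h1, ← h2, Measure.map_map hχ hS, Measure.map_map (by fun_prop) (by fun_prop)]
    congr 1
    ext a i
    · simp only [χ, S, d, Function.comp_apply, Pi.add_apply, Pi.sub_apply]
      ring
    · rfl
  have ref : ((π.prod π).prod ν).map χ = (P.map fun ω => F ω + E ω).prod π := by
    refine Measure.ext_of_lintegral _ fun g hg => ?_
    rw [hY, lintegral_map hg hχ, lintegral_prod_symm _ hg.aemeasurable,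
      lintegral_prod _ (Measurable.aemeasurable (by fun_prop)),
      lintegral_prod _ (Measurable.aemeasurable (by fun_prop))]
    refine lintegral_congr fun f => ?_
    rw [lintegral_map (by fun_prop) (by fun_prop),
      lintegral_prod _ (Measurable.aemeasurable (by fun_prop))]
  have hv' : (0 : ℝ) < v := by positivity
  -- second moments on the product space
  have hπ2 (i : ι) : MemLp (fun f : ι → ℝ => f i) 2 π := by
    rw [hπ, memLp_map_measure_iff (Measurable.aestronglyMeasurable (by fun_prop)) hF]
    exact hF2 i
  have hπc (i : ι) : ∫ f, f i ^ 2 ∂π ≤ c := by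
    rw [hπ, integral_map hF (Measurable.aestronglyMeasurable (by fun_prop))]
    exact hc i
  have hν2 (i : ι) : MemLp (fun e : ι → ℝ => e i) 2 ν :=
    (memLp_id_gaussianReal' 2 (by simp)).comp_measurePreserving
      (measurePreserving_eval (fun _ : ι => gaussianReal 0 v) i)
  have hνv (i : ι) : ∫ e, e i ^ 2 ∂ν = v := by
    have h := (measurePreserving_eval (fun _ : ι => gaussianReal 0 v) i)
    rw [show ∫ e, e i ^ 2 ∂ν = ∫ x, x ^ 2 ∂gaussianReal 0 v from
      integral_comp_measurePreserving h (g := fun x => x ^ 2) (by fun_prop)]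
    have := variance_fun_id_gaussianReal (μ := 0) (v := v)
    rw [variance_eq_integral (by fun_prop)] at this
    simpa using this
  have m11 : MeasurePreserving (fun a : ((ι → ℝ) × (ι → ℝ)) × (ι → ℝ) => a.1.1)
      ((π.prod π).prod ν) π := measurePreserving_fst.comp measurePreserving_fst
  have m12 : MeasurePreserving (fun a : ((ι → ℝ) × (ι → ℝ)) × (ι → ℝ) => a.1.2)
      ((π.prod π).prod ν) π := measurePreserving_snd.comp measurePreserving_fst
  have m2 : MeasurePreserving (fun a : ((ι → ℝ) × (ι → ℝ)) × (ι → ℝ) => a.2)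
      ((π.prod π).prod ν) ν := measurePreserving_snd
  have l11 (i : ι) := (hπ2 i).comp_measurePreserving m11
  have l12 (i : ι) := (hπ2 i).comp_measurePreserving m12
  have l2 (i : ι) := (hν2 i).comp_measurePreserving m2
  have s11 (i : ι) : Integrable (fun a => 2 * (a.1.1 i) ^ 2) ((π.prod π).prod ν) :=
    (l11 i).integrable_sq.const_mul 2
  have s12 (i : ι) : Integrable (fun a => 2 * (a.1.2 i) ^ 2) ((π.prod π).prod ν) :=
    (l12 i).integrable_sq.const_mul 2
  have s2 (i : ι) : Integrable (fun a => (a.2 i) ^ 2) ((π.prod π).prod ν) := (l2 i).integrable_sq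
  -- With `d = F₁ - F₂` the shifted log-density is `(d e + d² / 2) / v`, and `|d e + d² / 2| ≤ d² +
  -- e² / 2 ≤ e² + 2 F₁² + 2 F₂²`. This crude majorant gives both integrability and the constant `(v
  -- + 4c) / v`.
  let u : ι → ((ι → ℝ) × (ι → ℝ)) × (ι → ℝ) → ℝ := fun i a =>
    ((a.2 i) ^ 2 + (2 * (a.1.1 i) ^ 2 + 2 * (a.1.2 i) ^ 2)) / v
  have hu (i : ι) : Integrable (u i) ((π.prod π).prod ν) :=
    ((s2 i).add ((s11 i).add (s12 i))).div_const _
  have huc (i : ι) : ∫ a, u i a ∂((π.prod π).prod ν) ≤ (v + 4 * c) / v := by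
    have e11 : ∫ a, (a.1.1 i) ^ 2 ∂((π.prod π).prod ν) = ∫ f, f i ^ 2 ∂π :=
      integral_comp_measurePreserving m11 (g := fun f => f i ^ 2) (by fun_prop)
    have e12 : ∫ a, (a.1.2 i) ^ 2 ∂((π.prod π).prod ν) = ∫ f, f i ^ 2 ∂π :=
      integral_comp_measurePreserving m12 (g := fun f => f i ^ 2) (by fun_prop)
    have e2 : ∫ a, (a.2 i) ^ 2 ∂((π.prod π).prod ν) = v :=
      (integral_comp_measurePreserving m2 (g := fun e => e i ^ 2) (by fun_prop)).trans (hνv i)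
    have s112 : Integrable (fun a => 2 * (a.1.1 i) ^ 2 + 2 * (a.1.2 i) ^ 2) ((π.prod π).prod ν) :=
      (s11 i).add (s12 i)
    simp only [u]
    rw [integral_div, integral_add (s2 i) s112, integral_add (s11 i) (s12 i),
      integral_const_mul, integral_const_mul, e11, e12, e2]
    gcongr
    linarith [hπc i]
  have hbound (i : ι) (a : ((ι → ℝ) × (ι → ℝ)) × (ι → ℝ)) :
      |shiftLogDensity v (d a.1 i) ((S a).2 i)| ≤ u i a := by
    simp only [shiftLogDensity, S, d, u, Pi.add_apply, Pi.sub_apply]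
    rw [abs_div, abs_of_pos hv']
    gcongr
    rw [abs_le]
    constructor <;>
    nlinarith [sq_nonneg (a.1.1 i - a.1.2 i + a.2 i), sq_nonneg (a.1.1 i - a.1.2 i - a.2 i),
      sq_nonneg (a.1.1 i + a.1.2 i), sq_nonneg (a.2 i), sq_nonneg (a.1.1 i), sq_nonneg (a.1.2 i)]
  have hqS (i : ι) : Integrable (fun a => shiftLogDensity v (d a.1 i) ((S a).2 i))
      ((π.prod π).prod ν) :=
    (hu i).mono' (Measurable.aestronglyMeasurable (by fun_prop)) (ae_of_all _ (hbound i))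
  have hprob : IsProbabilityMeasure (((π.prod π).prod ν).map S) :=
    Measure.isProbabilityMeasure_map hS.aemeasurable
  have hqint : Integrable q (((π.prod π).prod ν).map S) := by
    rw [integrable_map_measure (by fun_prop) (by fun_prop)]
    exact integrable_finsetSum _ fun i _ => hqS i
  have hqle : ∫ a, q a ∂((π.prod π).prod ν).map S ≤ Fintype.card ι * ((v + 4 * c) / v) := by
    rw [integral_map (by fun_prop) (by fun_prop)]
    calc ∫ a, q (S a) ∂((π.prod π).prod ν)
      _ = ∑ i, ∫ a, shiftLogDensity v (d a.1 i) ((S a).2 i) ∂((π.prod π).prod ν) :=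
        integral_finsetSum _ fun i _ => hqS i
      _ ≤ ∑ _i : ι, (v + 4 * c) / v := Finset.sum_le_sum fun i _ =>
        (integral_mono (hqS i) (hu i) fun a => (abs_le.1 (hbound i a)).2).trans (huc i)
      _ = Fintype.card ι * ((v + 4 * c) / v) := by simp
  calc mutualInfo P (fun ω => F ω + E ω) F
    _ ≤ klDiv (((π.prod π).prod ν).map S) ((π.prod π).prod ν) := by
      rw [mutualInfo, ← hπ, ← joint, ← ref]
      exact klDiv_map_le _ _ hχ
    _ = ENNReal.ofReal (∫ a, q a ∂((π.prod π).prod ν).map S) := by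
      rw [hdens] at hprob hqint ⊢
      exact klDiv_withDensity_exp hq hprob hqint
    _ ≤ _ := ENNReal.ofReal_le_ofReal hqle

end GaussianShift

/-! ### Gaussian vectors are determined by mean and covariance. -/

section GaussianVectors

variable {Ω Ω' ι : Type*} [MeasurableSpace Ω] [MeasurableSpace Ω'] [Fintype ι]

theorem strongDual_apply_eq_sum [DecidableEq ι] (L : StrongDual ℝ (ι → ℝ)) (x : ι → ℝ) :
    L x = ∑ i, x i * L (Pi.single i 1) := by
  conv_lhs => rw [pi_eq_sum_univ' x]
  simp [map_sum]

/-- Gaussian vectors with equal means and covariances have the same law. -/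
theorem map_eq_of_hasGaussianLaw_of_cov {P : Measure Ω} {P' : Measure Ω'} [IsProbabilityMeasure P]
    [IsProbabilityMeasure P'] {X : Ω → ι → ℝ} {X' : Ω' → ι → ℝ} (hX : HasGaussianLaw X P)
    (hX' : HasGaussianLaw X' P') (hm : ∀ i, ∫ ω, X ω i ∂P = ∫ ω, X' ω i ∂P')
    (hc : ∀ i j, covariance (fun ω => X ω i) (fun ω => X ω j) P =
      covariance (fun ω => X' ω i) (fun ω => X' ω j) P') :
    P.map X = P'.map X' := by
  classical
  have := hX.isGaussian_map
  have := hX'.isGaussian_map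
  have hX2 (i : ι) : MemLp (fun ω => X ω i) 2 P := (hX.eval i).memLp_two
  have hX2' (i : ι) : MemLp (fun ω => X' ω i) 2 P' := (hX'.eval i).memLp_two
  -- The characteristic function at `L` sees only the mean and variance of `L X`, which expand into
  -- the means and covariances of the coordinates.
  refine Measure.ext_of_charFunDual (funext fun L => ?_)
  rw [hX.charFunDual_map_eq_fun, hX'.charFunDual_map_eq_fun]
  rw [funext fun ω => strongDual_apply_eq_sum L (X ω),
    funext fun ω => strongDual_apply_eq_sum L (X' ω)]
  have e1 : ∫ ω, ∑ i, X ω i * L (Pi.single i 1) ∂P =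
      ∫ ω, ∑ i, X' ω i * L (Pi.single i 1) ∂P' := by
    rw [integral_finsetSum _ fun i _ => ((hX2 i).integrable (by simp)).mul_const _,
      integral_finsetSum _ fun i _ => ((hX2' i).integrable (by simp)).mul_const _]
    simp_rw [integral_mul_const, hm]
  have e2 : variance (fun ω => ∑ i, X ω i * L (Pi.single i 1)) P =
      variance (fun ω => ∑ i, X' ω i * L (Pi.single i 1)) P' := by
    rw [variance_fun_sum' fun i _ => (hX2 i).mul_const _,
      variance_fun_sum' fun i _ => (hX2' i).mul_const _]
    simp_rw [covariance_mul_const_left, covariance_mul_const_right, hc]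
  rw [e1, e2]

theorem hasGaussianLaw_sub_const {P : Measure Ω} {X : Ω → ι → ℝ} (hX : HasGaussianLaw X P)
    (c : ι → ℝ) : HasGaussianLaw (fun ω => X ω - c) P where
  isGaussian_map := by
    have := hX.isGaussian_map
    have h : P.map (fun ω => X ω - c) = (P.map X).map (· - c) := by
      rw [AEMeasurable.map_map_of_aemeasurable (by fun_prop) hX.aemeasurable]
      rfl
    rw [h]
    infer_instance

end GaussianVectors

/-- The joint law is a threefold product, and reassociating it moves `V` to the other side. It
serves to separate the noise of task `k` from the values together with the noise of the other tasks.
-/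
theorem indepFun_prodMk_left {Ω A B C : Type*} [MeasurableSpace Ω] [MeasurableSpace A]
    [MeasurableSpace B] [MeasurableSpace C] {P : Measure Ω} [IsProbabilityMeasure P] {U : Ω → A}
    {V : Ω → B} {W : Ω → C} (hU : AEMeasurable U P) (hV : AEMeasurable V P)
    (hW : AEMeasurable W P) (h : IndepFun U (fun ω => (V ω, W ω)) P) (hVW : IndepFun V W P) :
    IndepFun (fun ω => (U ω, V ω)) W P := by
  have hUV : IndepFun U V P := h.comp measurable_id measurable_fst
  rw [indepFun_iff_map_prod_eq_prod_map_map (hU.prodMk hV) hW,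
    hUV.map_prod_eq_prod_map_map hU hV]
  have e := h.map_prod_eq_prod_map_map hU (hV.prodMk hW)
  rw [hVW.map_prod_eq_prod_map_map hV hW] at e
  have := congrArg (Measure.map MeasurableEquiv.prodAssoc.symm) e
  rw [AEMeasurable.map_map_of_aemeasurable (by fun_prop) (by fun_prop),
    ← Measure.prodAssoc_prod, MeasurableEquiv.map_symm_map] at this
  exact this

/-! ### Information gains of noisy Gaussian processes. -/

section NoisyGP

variable {Ω Ω' S S' N N' ι : Type*} [MeasurableSpace Ω] [MeasurableSpace Ω'] [Fintype ι]
  {P : Measure Ω} {P' : Measure Ω'}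
  {I : Set S} {f : S → Ω → ℝ} {mean : S → ℝ} {κ : S → S → ℝ} {ε : N → Ω → ℝ} {v : ℝ≥0}
  {I' : Set S'} {f' : S' → Ω' → ℝ} {mean' : S' → ℝ} {κ' : S' → S' → ℝ} {ε' : N' → Ω' → ℝ}

namespace IsNoisyGP

theorem hasGaussianLaw (h : IsNoisyGP P I f mean κ ε v) {x : ι → S} (hx : ∀ i, x i ∈ I) :
    HasGaussianLaw (fun ω i => f (x i) ω) P := by
  classical
  let y : ι → I := fun i => ⟨x i, hx i⟩
  let L : (Finset.univ.image y → ℝ) →L[ℝ] (ι → ℝ) :=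
    ContinuousLinearMap.pi fun i => ContinuousLinearMap.proj ⟨y i, by simp⟩
  exact (h.gaussian.hasGaussianLaw (Finset.univ.image y)).map L

theorem aemeasurable_eval (h : IsNoisyGP P I f mean κ ε v) {q : S} (hq : q ∈ I) :
    AEMeasurable (f q) P :=
  h.gaussian.aemeasurable ⟨q, hq⟩

theorem memLp_two (h : IsNoisyGP P I f mean κ ε v) {q : S} (hq : q ∈ I) : MemLp (f q) 2 P :=
  (h.gaussian.hasGaussianLaw_eval ⟨q, hq⟩).memLp_two

theorem aemeasurable_noise (h : IsNoisyGP P I f mean κ ε v) (n : N) : AEMeasurable (ε n) P :=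
  (h.noise_law n).aemeasurable

theorem hasGaussianLaw_centered (h : IsNoisyGP P I f mean κ ε v) {x : ι → S}
    (hx : ∀ i, x i ∈ I) : HasGaussianLaw (fun ω i => f (x i) ω - mean (x i)) P :=
  hasGaussianLaw_sub_const (h.hasGaussianLaw hx) fun i => mean (x i)

theorem integral_sq_centered_le (h : IsNoisyGP P I f mean κ ε v) {q : S} (hq : q ∈ I) :
    ∫ ω, (f q ω - mean q) ^ 2 ∂P ≤ 1 := by
  have h1 := h.cov_eq q hq q hq
  rw [covariance_self (h.aemeasurable_eval hq), variance_eq_integral (h.aemeasurable_eval hq),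
    h.mean_eq q hq] at h1
  exact h1.trans_le (h.variance_le_one q hq)

theorem map_noise_eq (h : IsNoisyGP P I f mean κ ε v) {n : ι → N} (hn : n.Injective) :
    P.map (fun ω i => ε (n i) ω) = Measure.pi fun _ => gaussianReal 0 v := by
  rw [(h.noise_iIndep.precomp hn).map_fun_eq_pi_map fun i => h.aemeasurable_noise (n i)]
  simp_rw [(h.noise_law _).map_eq]

theorem indepFun_values_noise (h : IsNoisyGP P I f mean κ ε v) {α β : Type*} {x : α → S}
    (hx : ∀ i, x i ∈ I) (n : β → N) :
    IndepFun (fun ω i => f (x i) ω) (fun ω i => ε (n i) ω) P :=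
  h.noise_indep.comp (φ := fun (g : I → ℝ) i => g ⟨x i, hx i⟩)
    (ψ := fun (e : N → ℝ) i => e (n i)) (by fun_prop) (by fun_prop)

theorem aemeasurable_noise_vector (h : IsNoisyGP P I f mean κ ε v) {α : Type*} [Countable α]
    (n : α → N) : AEMeasurable (fun ω i => ε (n i) ω) P :=
  aemeasurable_pi_lambda _ fun i => h.aemeasurable_noise (n i)

theorem indepFun_centered_noise (h : IsNoisyGP P I f mean κ ε v) {α β : Type*} {x : α → S}
    (hx : ∀ i, x i ∈ I) (n : β → N) :
    IndepFun (fun ω i => f (x i) ω - mean (x i)) (fun ω i => ε (n i) ω) P :=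
  (h.indepFun_values_noise hx n).comp (φ := fun (g : α → ℝ) i => g i - mean (x i))
    (by fun_prop) measurable_id

theorem aemeasurable_centered (h : IsNoisyGP P I f mean κ ε v) {x : ι → S}
    (hx : ∀ i, x i ∈ I) : AEMeasurable (fun ω i => f (x i) ω - mean (x i)) P :=
  (h.hasGaussianLaw_centered hx).aemeasurable

variable [IsProbabilityMeasure P] [IsProbabilityMeasure P']

theorem integral_centered (h : IsNoisyGP P I f mean κ ε v) {q : S} (hq : q ∈ I) :
    ∫ ω, (f q ω - mean q) ∂P = 0 := by
  rw [integral_sub ((h.memLp_two hq).integrable (by simp)) (integrable_const _), h.mean_eq q hq]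
  simp

theorem covariance_centered (h : IsNoisyGP P I f mean κ ε v) {q q' : S} (hq : q ∈ I)
    (hq' : q' ∈ I) :
    covariance (fun ω => f q ω - mean q) (fun ω => f q' ω - mean q') P = κ q q' := by
  rw [covariance_sub_const_left ((h.memLp_two hq).integrable (by simp)),
    covariance_sub_const_right ((h.memLp_two hq').integrable (by simp)), h.cov_eq q hq q' hq']

/-- The centred values of two processes with the same covariances have the same law. -/
theorem map_centered_eq (h : IsNoisyGP P I f mean κ ε v)
    (h' : IsNoisyGP P' I' f' mean' κ' ε' v) {x : ι → S} {x' : ι → S'} (hx : ∀ i, x i ∈ I)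
    (hx' : ∀ i, x' i ∈ I') (hκ : ∀ i j, κ (x i) (x j) = κ' (x' i) (x' j)) :
    P.map (fun ω i => f (x i) ω - mean (x i)) =
      P'.map fun ω i => f' (x' i) ω - mean' (x' i) := by
  refine map_eq_of_hasGaussianLaw_of_cov (h.hasGaussianLaw_centered hx)
    (h'.hasGaussianLaw_centered hx') (fun i => ?_) fun i j => ?_
  · rw [h.integral_centered (hx i), h'.integral_centered (hx' i)]
  · rw [h.covariance_centered (hx i) (hx j), h'.covariance_centered (hx' i) (hx' j), hκ]

/-- Subtracting the means does not change the information gain. -/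
theorem mutualInfo_eq_centered (h : IsNoisyGP P I f mean κ ε v) {x : ι → S} (hx : ∀ i, x i ∈ I)
    (n : ι → N) :
    mutualInfo P (fun ω i => f (x i) ω + ε (n i) ω) (fun ω i => f (x i) ω) =
      mutualInfo P ((fun ω i => f (x i) ω - mean (x i)) + fun ω i => ε (n i) ω)
        (fun ω i => f (x i) ω - mean (x i)) := by
  have hF := (h.hasGaussianLaw hx).aemeasurable
  have hF0 := h.aemeasurable_centered hx
  have hE := h.aemeasurable_noise_vector n
  -- Translations are invertible, so data processing applies in both directions.
  refine le_antisymm ?_ ?_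
  · have := mutualInfo_comp_le (hF0.add hE) hF0 (φ := fun y => y + fun i => mean (x i))
      (ψ := fun y => y + fun i => mean (x i)) (by fun_prop) (by fun_prop)
    refine le_of_eq_of_le ?_ this
    congr 1 <;> ext ω i <;> simp
    ring
  · have := mutualInfo_comp_le (hF.add hE) hF (φ := fun y => y - fun i => mean (x i))
      (ψ := fun y => y - fun i => mean (x i)) (by fun_prop) (by fun_prop)
    refine le_of_eq_of_le ?_ this
    congr 1
    ext ω i
    simp
    ring

/-- The information gain depends only on the covariances of the values and on the noise variance. -/
theorem mutualInfo_eq (h : IsNoisyGP P I f mean κ ε v)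
    (h' : IsNoisyGP P' I' f' mean' κ' ε' v) {x : ι → S} {x' : ι → S'} (hx : ∀ i, x i ∈ I)
    (hx' : ∀ i, x' i ∈ I') (hκ : ∀ i j, κ (x i) (x j) = κ' (x' i) (x' j))
    {n : ι → N} {n' : ι → N'} (hn : n.Injective) (hn' : n'.Injective) :
    mutualInfo P (fun ω i => f (x i) ω + ε (n i) ω) (fun ω i => f (x i) ω) =
      mutualInfo P' (fun ω i => f' (x' i) ω + ε' (n' i) ω) (fun ω i => f' (x' i) ω) := by
  have hF := h.aemeasurable_centered hx
  have hF' := h'.aemeasurable_centered hx'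
  have hE := h.aemeasurable_noise_vector n
  have hE' := h'.aemeasurable_noise_vector n'
  rw [h.mutualInfo_eq_centered hx, h'.mutualInfo_eq_centered hx']
  refine mutualInfo_congr (hF.add hE) hF (hF'.add hE') hF' ?_
  have key : P.map (fun ω => ((fun i => f (x i) ω - mean (x i)), fun i => ε (n i) ω)) =
      P'.map fun ω => ((fun i => f' (x' i) ω - mean' (x' i)), fun i => ε' (n' i) ω) := by
    rw [(h.indepFun_centered_noise hx n).map_prod_eq_prod_map_map hF hE,
      (h'.indepFun_centered_noise hx' n').map_prod_eq_prod_map_map hF' hE',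
      h.map_noise_eq hn, h'.map_noise_eq hn', h.map_centered_eq h' hx hx' hκ]
  have := congrArg (Measure.map fun a : (ι → ℝ) × (ι → ℝ) => (a.1 + a.2, a.1)) key
  rwa [AEMeasurable.map_map_of_aemeasurable (by fun_prop) (hF.prodMk hE),
    AEMeasurable.map_map_of_aemeasurable (by fun_prop) (hF'.prodMk hE')] at this

/-- Centring comes first because the second moments of the raw values involve the mean; after it,
the variance bound allows `c = 1`. The resulting bound does not depend on the design `x`. -/
theorem mutualInfo_le (h : IsNoisyGP P I f mean κ ε v) (hv : v ≠ 0) {x : ι → S}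
    (hx : ∀ i, x i ∈ I) {n : ι → N} (hn : n.Injective) :
    mutualInfo P (fun ω i => f (x i) ω + ε (n i) ω) (fun ω i => f (x i) ω) ≤
      ENNReal.ofReal (Fintype.card ι * ((v + 4 * 1) / v)) := by
  rw [h.mutualInfo_eq_centered hx]
  exact mutualInfo_add_gaussian_le hv (h.aemeasurable_centered hx) (h.map_noise_eq hn)
    (h.indepFun_centered_noise hx n)
    (fun i => (h.memLp_two (hx i)).sub (memLp_const _))
    fun i => h.integral_sq_centered_le (hx i)

/-- Conditioning on noisy observations at other inputs, with other noise variables, does not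
increase the information gain. -/
theorem condMutualInfo_le (h : IsNoisyGP P I f mean κ ε v) {x : ι → S} (hx : ∀ i, x i ∈ I)
    {ι' : Type*} [Fintype ι'] {x' : ι' → S} (hx' : ∀ i, x' i ∈ I) {n : ι → N} {n' : ι' → N}
    (hn : (Sum.elim n n').Injective) :
    condMutualInfo P (fun ω i => f (x i) ω + ε (n i) ω) (fun ω i => f (x i) ω)
        (fun ω i => f (x' i) ω + ε (n' i) ω) ≤
      mutualInfo P (fun ω i => f (x i) ω + ε (n i) ω) (fun ω i => f (x i) ω) := by
  have hF := (h.hasGaussianLaw hx).aemeasurable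
  have hF' := (h.hasGaussianLaw hx').aemeasurable
  have hE := h.aemeasurable_noise_vector n
  have hE' := h.aemeasurable_noise_vector n'
  -- Injectivity of `Sum.elim n n'` makes the two noise vectors disjoint subfamilies of an
  -- independent family.
  have hEE : IndepFun (fun ω i => ε (n' i) ω) (fun ω i => ε (n i) ω) P := by
    classical
    have hsum : iIndepFun (fun j => ε (Sum.elim n n' j)) P := h.noise_iIndep.precomp hn
    have := hsum.indepFun_finset₀ (Finset.univ.map .inr) (Finset.univ.map .inl)
      (by simp [Finset.disjoint_left]) fun j => h.aemeasurable_noise _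
    exact this.comp
      (φ := fun (e : (Finset.univ.map .inr : Finset (ι ⊕ ι')) → ℝ) i => e ⟨Sum.inr i, by simp⟩)
      (ψ := fun (e : (Finset.univ.map .inl : Finset (ι ⊕ ι')) → ℝ) i => e ⟨Sum.inl i, by simp⟩)
      (by fun_prop) (by fun_prop)
  have hFF : IndepFun (fun ω => ((fun i => f (x i) ω), fun i => f (x' i) ω))
      (fun ω => ((fun i => ε (n' i) ω), fun i => ε (n i) ω)) P :=
    h.noise_indep.comp
      (φ := fun (g : I → ℝ) => ((fun i => g ⟨x i, hx i⟩), fun i => g ⟨x' i, hx' i⟩))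
      (ψ := fun (e : N → ℝ) => ((fun i => e (n' i)), fun i => e (n i))) (by fun_prop) (by fun_prop)
  have hind : IndepFun (fun ω => (((fun i => f (x i) ω), fun i => f (x' i) ω),
      fun i => ε (n' i) ω)) (fun ω i => ε (n i) ω) P :=
    indepFun_prodMk_left (hF.prodMk hF') hE' hE hFF hEE
  exact condMutualInfo_le_mutualInfo_of_indepFun hE hF (hF'.add hE')
    (hind.comp (φ := fun a => (a.1.1, a.1.2 + a.2)) (by fun_prop) measurable_id)
    (φ := fun a => a.1 + a.2) (by fun_prop)

end IsNoisyGP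

end NoisyGP

/-! ### Comparison of the maximum information gains. -/

section InformationGains

variable {Ω Ω' X Θ : Type*} [MeasurableSpace Ω] [MeasurableSpace Ω'] {K : ℕ}
  {P : Measure Ω} [IsProbabilityMeasure P] {P' : Measure Ω'} [IsProbabilityMeasure P']
  {𝒳 : Set X} {𝒯 : Set Θ} {θ : Fin K → Θ} {v : ℝ≥0}
  {g : X → Ω' → ℝ} {η : ℕ → Ω' → ℝ} {μ : X → ℝ} {κ : X → X → ℝ}
  {f : X × Θ → Ω → ℝ} {ε : Fin K × ℕ → Ω → ℝ} {μt : X × Θ → ℝ} {κt : X × Θ → X × Θ → ℝ}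

theorem stMIG_lt_top (hg : IsNoisyGP P' 𝒳 g μ κ η v) (hv : v ≠ 0) (T : ℕ) :
    stMIG P' 𝒳 g η T < ⊤ := by
  refine lt_of_le_of_lt (b := ENNReal.ofReal (Fintype.card (Fin T) * ((v + 4 * 1) / v)))
    (iSup_le fun x => ?_) ENNReal.ofReal_lt_top
  exact hg.mutualInfo_le hv (x := fun t => (x t : X)) (fun t => (x t).2) Fin.val_injective

theorem pmtMIG_le_stMIG (hf : IsNoisyGP P (𝒳 ×ˢ 𝒯) f μt κt ε v)
    (hg : IsNoisyGP P' 𝒳 g μ κ η v) (hθ : ∀ k, θ k ∈ 𝒯) {k : Fin K}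
    (hκ : ∀ x ∈ 𝒳, ∀ x' ∈ 𝒳, κt (x, θ k) (x', θ k) = κ x x') (T : ℕ) (z : Fin K → Fin T → 𝒳) :
    pmtMIG P 𝒳 θ f ε k T z ≤ stMIG P' 𝒳 g η T := by
  refine iSup_le fun x => ?_
  have hx (t : Fin T) : ((x t : X), θ k) ∈ 𝒳 ×ˢ 𝒯 := ⟨(x t).2, hθ k⟩
  have hn : (fun t : Fin T => (k, (t : ℕ))).Injective := fun t t' h =>
    Fin.ext (Prod.ext_iff.1 h).2
  have hn' : (Sum.elim (fun t : Fin T => (k, (t : ℕ)))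
      fun i : {j : Fin K // j ≠ k} × Fin T => ((i.1 : Fin K), (i.2 : ℕ))).Injective := by
    -- Noise indices of task `k` and of the others cannot coincide, because the task components `k`
    -- and `j ≠ k` differ.
    refine hn.sumElim (fun i i' h => ?_) fun t i h => i.1.2 (Prod.ext_iff.1 h).1.symm
    exact Prod.ext (Subtype.ext (Prod.ext_iff.1 h).1) (Fin.ext (Prod.ext_iff.1 h).2)
  refine (hf.condMutualInfo_le hx
    (x' := fun i : {j : Fin K // j ≠ k} × Fin T => ((z i.1 i.2 : X), θ i.1))
    (fun i => ⟨(z i.1 i.2).2, hθ i.1⟩) hn').trans ?_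
  rw [hf.mutualInfo_eq hg hx (x' := fun t => (x t : X)) (fun t => (x t).2)
    (fun t t' => hκ _ (x t).2 _ (x t').2) hn Fin.val_injective]
  exact le_iSup (fun x : Fin T → 𝒳 =>
    mutualInfo P' (fun ω (t : Fin T) => g (x t) ω + η t ω) (fun ω (t : Fin T) => g (x t) ω)) x

end InformationGains

/-! ### Monotonicity of the regret expressions in the information gain. -/

section RegretBounds

/-- Finiteness of `γ'` is essential: `toReal` sends `⊤` to `0`, which could reverse the inequality.
-/
theorem regretRate_mono {J : ℝ≥0} {M D : ℕ} {σ2 : ℝ≥0} {γ γ' : ℝ≥0∞} (h : γ ≤ γ') (hγ' : γ' ≠ ⊤)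
    (T : ℕ) : regretRate J M D σ2 γ T ≤ regretRate J M D σ2 γ' T := by
  have h1 : γ.toReal ≤ γ'.toReal := ENNReal.toReal_mono hγ' h
  -- The default values are covered: `Real.log 0 = 0` for `T = 0`, and the quotient is `0` for `σ2 =
  -- 0`.
  have h2 : 0 ≤ Real.log T / Real.log (1 + (σ2 : ℝ)⁻¹) :=
    div_nonneg (Real.log_natCast_nonneg T)
      (Real.log_nonneg (le_add_of_nonneg_right (by positivity)))
  unfold regretRate
  gcongr

theorem bayesBound_mono {J : ℝ≥0} {M D : ℕ} {σ2 : ℝ≥0} {C : ℝ} {r : ℕ → ℝ} {γ γ' : ℝ≥0∞}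
    (h : γ ≤ γ') (hγ' : γ' ≠ ⊤) (hC : 0 ≤ C) (T : ℕ) :
    bayesBound J M D σ2 C r γ T ≤ bayesBound J M D σ2 C r γ' T := by
  have := regretRate_mono (J := J) (M := M) (D := D) (σ2 := σ2) h hγ' T
  unfold bayesBound
  gcongr

end RegretBounds

end PMTMOBO

/-! ### The main theorem. -/

theorem theorem2
    {D V M K : ℕ}
    -- domain, task parameters
    (𝒳 : Set (Fin D → ℝ)) (h𝒳 : IsCompact 𝒳) (h𝒳_sub : 𝒳 ⊆ Set.Icc 0 1)
    (𝒯 : Set (Fin V → ℝ)) (θ : Fin K → (Fin V → ℝ)) (hθ : ∀ k, θ k ∈ 𝒯)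
    -- noise variances of the objectives and their upper bound
    (v : Fin M → ℝ≥0) (σ2 : ℝ≥0) (hv_pos : ∀ m, 0 < v m) (hv : ∀ m, v m ≤ σ2)
    -- single-task model: one Gaussian process for every objective and every task
    {Ω₁ : Type*} [MeasurableSpace Ω₁] (P₁ : Measure Ω₁) [IsProbabilityMeasure P₁]
    (g : Fin M → Fin K → (Fin D → ℝ) → Ω₁ → ℝ) (η : Fin M → Fin K → ℕ → Ω₁ → ℝ)
    (μ : Fin M → Fin K → (Fin D → ℝ) → ℝ)
    (κ : Fin M → (Fin D → ℝ) → (Fin D → ℝ) → ℝ)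
    (hg : ∀ m k, PMTMOBO.IsNoisyGP P₁ 𝒳 (g m k) (μ m k) (κ m) (η m k) (v m))
    -- task-aware model: one Gaussian process on the joint space for every objective
    {Ω : Type*} [MeasurableSpace Ω] (P : Measure Ω) [IsProbabilityMeasure P]
    (f : Fin M → (Fin D → ℝ) × (Fin V → ℝ) → Ω → ℝ) (ε : Fin M → Fin K × ℕ → Ω → ℝ)
    (μt : Fin M → (Fin D → ℝ) × (Fin V → ℝ) → ℝ)
    (κt : Fin M → (Fin D → ℝ) × (Fin V → ℝ) → (Fin D → ℝ) × (Fin V → ℝ) → ℝ)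
    (hf : ∀ m, PMTMOBO.IsNoisyGP P (𝒳 ×ˢ 𝒯) (f m) (μt m) (κt m) (ε m) (v m))
    -- the task-aware kernel restricted to a single task is the single-task kernel
    (hκ : ∀ m k, ∀ x ∈ 𝒳, ∀ x' ∈ 𝒳, κt m (x, θ k) (x', θ k) = κ m x x')
    -- scalarizations and preference distribution
    {L : Type*} [NormedAddCommGroup L] [NormedSpace ℝ L] [MeasurableSpace L] [BorelSpace L]
    (Λ : Set L) (s : L → (Fin M → ℝ) → ℝ) (Jl : L → ℝ≥0) (J : ℝ≥0)
    (hs : PMTMOBO.IsScalarization Λ s Jl J)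
    (p : Measure L) [IsProbabilityMeasure p] (hp : ∀ᵐ l ∂p, l ∈ Λ) :
    -- the information gains are finite
    (∀ (m : Fin M) (k : Fin K) (T : ℕ), PMTMOBO.stMIG P₁ 𝒳 (g m k) (η m k) T < ⊤) ∧
    -- comparison for every objective and every task
    (∀ (m : Fin M) (k : Fin K) (T : ℕ) (z : Fin K → Fin T → 𝒳),
      PMTMOBO.pmtMIG P 𝒳 θ (f m) (ε m) k T z ≤ PMTMOBO.stMIG P₁ 𝒳 (g m k) (η m k) T) ∧
    -- comparison for every task
    (∀ (k : Fin K) (T : ℕ) (z : Fin K → Fin T → 𝒳),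
      PMTMOBO.pmtMIGMax P 𝒳 θ f ε k T z ≤
        PMTMOBO.stMIGMax P₁ 𝒳 (fun m => g m k) (fun m => η m k) T) ∧
    -- comparison of the regret bounds
    (∀ (k : Fin K) (T : ℕ) (z : Fin K → Fin T → 𝒳),
      PMTMOBO.regretRate J M D σ2 (PMTMOBO.pmtMIGMax P 𝒳 θ f ε k T z) T ≤
        PMTMOBO.regretRate J M D σ2
          (PMTMOBO.stMIGMax P₁ 𝒳 (fun m => g m k) (fun m => η m k) T) T ∧
      ∀ (C : ℝ) (r : ℕ → ℝ), 0 ≤ C →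
        PMTMOBO.bayesBound J M D σ2 C r (PMTMOBO.pmtMIGMax P 𝒳 θ f ε k T z) T ≤
          PMTMOBO.bayesBound J M D σ2 C r
            (PMTMOBO.stMIGMax P₁ 𝒳 (fun m => g m k) (fun m => η m k) T) T) ∧
    -- consequence for the expected Bayes regret of PMT-MOBO
    (∀ (β : ℕ → ℝ≥0) (lam : ℕ → Ω → L) (x : Fin K → ℕ → Ω → (Fin D → ℝ)),
      PMTMOBO.IsPMTRun P p 𝒳 𝒯 θ f ε μt κt v s β lam x →
      ∀ k : Fin K,
        PMTMOBO.RegretsWellDefined P p 𝒳 Λ s (fun ω x' m => f m (x', θ k) ω) lam (x k) →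
      ∀ (z : ∀ T : ℕ, Fin K → Fin T → 𝒳) (C : ℝ) (r : ℕ → ℝ), 0 ≤ C → Tendsto r atTop (𝓝 0) →
        (∀ᶠ T : ℕ in atTop,
          ∫ ω, PMTMOBO.cumulativeRegret 𝒳 Λ s (fun x' m => f m (x', θ k) ω)
              (fun t => lam t ω) (fun t => x k t ω) T ∂P ≤
            C * PMTMOBO.regretRate J M D σ2 (PMTMOBO.pmtMIGMax P 𝒳 θ f ε k T (z T)) T) →
        (∀ᶠ T : ℕ in atTop,
          ∫ ω, PMTMOBO.bayesRegret p 𝒳 Λ s (fun x' m => f m (x', θ k) ω)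
              (fun t => x k t ω) T ∂P ≤
            1 / (T : ℝ) * ∫ ω, PMTMOBO.cumulativeRegret 𝒳 Λ s (fun x' m => f m (x', θ k) ω)
              (fun t => lam t ω) (fun t => x k t ω) T ∂P + r T) →
        ∀ᶠ T : ℕ in atTop,
          ∫ ω, PMTMOBO.bayesRegret p 𝒳 Λ s (fun x' m => f m (x', θ k) ω)
              (fun t => x k t ω) T ∂P ≤
            PMTMOBO.bayesBound J M D σ2 C r (PMTMOBO.pmtMIGMax P 𝒳 θ f ε k T (z T)) T ∧
          PMTMOBO.bayesBound J M D σ2 C r (PMTMOBO.pmtMIGMax P 𝒳 θ f ε k T (z T)) T ≤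
            PMTMOBO.bayesBound J M D σ2 C r
              (PMTMOBO.stMIGMax P₁ 𝒳 (fun m => g m k) (fun m => η m k) T) T) := by
  have hfin (m : Fin M) (k : Fin K) (T : ℕ) : PMTMOBO.stMIG P₁ 𝒳 (g m k) (η m k) T < ⊤ :=
    PMTMOBO.stMIG_lt_top (hg m k) (hv_pos m).ne' T
  have hle (m : Fin M) (k : Fin K) (T : ℕ) (z : Fin K → Fin T → 𝒳) :
      PMTMOBO.pmtMIG P 𝒳 θ (f m) (ε m) k T z ≤ PMTMOBO.stMIG P₁ 𝒳 (g m k) (η m k) T :=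
    PMTMOBO.pmtMIG_le_stMIG (hf m) (hg m k) hθ (hκ m k) T z
  have hmax (k : Fin K) (T : ℕ) (z : Fin K → Fin T → 𝒳) :
      PMTMOBO.pmtMIGMax P 𝒳 θ f ε k T z ≤
        PMTMOBO.stMIGMax P₁ 𝒳 (fun m => g m k) (fun m => η m k) T :=
    iSup_mono fun m => hle m k T z
  have hmax_fin (k : Fin K) (T : ℕ) :
      PMTMOBO.stMIGMax P₁ 𝒳 (fun m => g m k) (fun m => η m k) T ≠ ⊤ :=
    -- The maximum over objectives is at most their finite sum; this also covers `M = 0`.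
    ne_top_of_le_ne_top (ENNReal.sum_lt_top.2 fun m (_ : m ∈ Finset.univ) => hfin m k T).ne
      (iSup_le fun m => Finset.single_le_sum (f := fun m => PMTMOBO.stMIG P₁ 𝒳 (g m k) (η m k) T)
        (fun _ _ => zero_le) (Finset.mem_univ m))
  refine ⟨hfin, hle, hmax, fun k T z => ⟨PMTMOBO.regretRate_mono (hmax k T z) (hmax_fin k T) T,
    fun C r hC => PMTMOBO.bayesBound_mono (hmax k T z) (hmax_fin k T) hC T⟩, ?_⟩
  intro β lam x _ k _ z C r hC _ hcum hbayes
  filter_upwards [hcum, hbayes] with T h1 h2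
  refine ⟨h2.trans ?_, PMTMOBO.bayesBound_mono (hmax k T (z T)) (hmax_fin k T) hC T⟩
  unfold PMTMOBO.bayesBound
  gcongr
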